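/- Let $d_1,d_2,n$ be positive integers, $0\le q<1$, and $\rho\in\mathbb R$. For a quaternion matrix $A\in\mathbb Q^{d_1\times d_2}$ let $\sigma_1(A)\ge\dots\ge\sigma_{\min\{d_1,d_2\}}(A)\ge 0$ be its singular values (the diagonal entries in a decomposition $A=U\Sigma V^*$ with quaternion unitary $U,V$), and put $\|A\|_{\mathrm{nu}}=\sum_i\sigma_i(A)$, $\|A\|_{\mathrm F}=(\sum_{i,j}|a_{ij}|^2)^{1/2}$, $\|A\|_{\mathrm{op}}=\sup_{x\ne0}\|Ax\|_2/\|x\|_2$, $\|A\|_\infty=\max_{i,j}|a_{ij}|$, and $\langle A,B\rangle=\operatorname{Tr}(A^*B)$. Let $\mathbb Q_{\mathrm{pix}}$ be the set of quaternions $q_1\mathbf i+q_2\mathbf j+q_3\mathbf k$ with $q_1,q_2,q_3\ge 0$. Let $\widetilde\Theta\in\mathbb Q_{\mathrm{pix}}^{d_1\times d_2}$ satisfy $$\sum_{i=1}^{\min\{d_1,d_2\}}\sigma_i(\widetilde\Theta)^q\le\rho$$ (with $0^0=0$, so that for $q=0$ this says $\operatorname{rank}\widetilde\Theta\le\rho$),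 and let each of $X_1,\dots,X_n$ be one of the matrix units $e_ie_j^T\in\mathbb R^{d_1\times d_2}$. Both statements below hold for every realization of the sampled positions and of the noise. (1) (Clean model.) Let $Y_k=\langle X_k,\widetilde\Theta\rangle$ for $k=1,\dots,n$, let $\|\widetilde\Theta\|_\infty\le\alpha$, and let $\widehat\Theta$ be any minimizer of $\|\Theta\|_{\mathrm{nu}}$ over all $\Theta\in\mathbb Q_{\mathrm{pix}}^{d_1\times d_2}$ with $\|\Theta\|_\infty\le\alpha$ and $\langle X_k,\Theta\rangle=Y_k$ for all $k$. Then $\widehat\Delta=\widehat\Theta-\widetilde\Theta$ satisfies $$\|\widehat\Delta\|_{\mathrm{nu}}\le 5\,\rho^{\frac1{2-q}}\,\|\widehat\Delta\|_{\mathrm F}^{\frac{2-2q}{2-q}}.$$ (2) (Corrupted model.) Let $W\in\mathbb R^{3\times3}$ be positive definite. Identify a pure quaternion $p=p_1\mathbf i+p_2\mathbf j+p_3\mathbf k$ with $(p_1,p_2,p_3)^T\in\mathbb R^3$, so that $Wp$ is again a pure quaternion, and put $|p|_{\mathrm w}=\sqrt{p^TWp}$ and $\|A\|_{\mathrm w,\infty}=\max_{i,j}|a_{ij}|_{\mathrm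 w}$. Let $Y_k=\langle X_k,\widetilde\Theta\rangle+\epsilon_k$ with pure quaternions $\epsilon_k$, let $\|\widetilde\Theta\|_{\mathrm w,\infty}\le\alpha$, let $\lambda>0$, and let $\widehat\Theta$ be any minimizer of $$\frac1{2n}\sum_{k=1}^n\big|Y_k-\langle X_k,\Theta\rangle\big|_{\mathrm w}^2+\lambda\|\Theta\|_{\mathrm{nu}}$$ over all $\Theta\in\mathbb Q_{\mathrm{pix}}^{d_1\times d_2}$ with $\|\Theta\|_{\mathrm w,\infty}\le\alpha$. If for some $C_1>1$ $$\lambda\ \ge\ C_1\Big\|\frac1n\sum_{k=1}^n(W\epsilon_k)X_k\Big\|_{\mathrm{op}},$$ then $\widehat\Delta=\widehat\Theta-\widetilde\Theta$ satisfies $$\|\widehat\Delta\|_{\mathrm{nu}}\le\frac{5C_1}{C_1-1}\,\rho^{\frac1{2-q}}\,\|\widehat\Delta\|_{\mathrm F}^{\frac{2-2q}{2-q}}.$$ -/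

import Mathlib

open scoped Quaternion Matrix

noncomputable section

namespace QMat

/-- Rectangular diagonal quaternion matrix with real diagonal entries `σ`. -/
def rectDiag {m n : ℕ} (σ : Fin (min m n) → ℝ) : Matrix (Fin m) (Fin n) ℍ[ℝ] :=
  Matrix.of fun i j =>
    if h : (i : ℕ) = (j : ℕ) then ((σ ⟨i, lt_min i.2 (h ▸ j.2)⟩ : ℝ) : ℍ[ℝ]) else 0

/-- `A = U Σ V*` with `U`, `V` unitary and `Σ` the rectangular diagonal matrix of the
non-negative reals `σ 0 ≥ σ 1 ≥ …`: a quaternion singular value decomposition of `A`. -/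
structure IsQSVD {m n : ℕ} (A : Matrix (Fin m) (Fin n) ℍ[ℝ])
    (U : Matrix (Fin m) (Fin m) ℍ[ℝ]) (σ : Fin (min m n) → ℝ)
    (V : Matrix (Fin n) (Fin n) ℍ[ℝ]) : Prop where
  left_unitary : U ∈ unitary (Matrix (Fin m) (Fin m) ℍ[ℝ])
  right_unitary : V ∈ unitary (Matrix (Fin n) (Fin n) ℍ[ℝ])
  nonneg : ∀ i, 0 ≤ σ i
  antitone : Antitone σ
  eq : A = U * rectDiag σ * Vᴴ

theorem re_mul_comm (a b : ℍ[ℝ]) : (a * b).re = (b * a).re := by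
  simp only [Quaternion.re_mul]; ring

theorem re_trace_mul_comm {m n : ℕ} (A : Matrix (Fin m) (Fin n) ℍ[ℝ])
    (B : Matrix (Fin n) (Fin m) ℍ[ℝ]) : (A * B).trace.re = (B * A).trace.re := by
  have hre : ∀ (k : ℕ) (f : Fin k → ℍ[ℝ]), (∑ i, f i).re = ∑ i, (f i).re := fun k f =>
    map_sum (QuaternionAlgebra.reₗ (-1 : ℝ) 0 (-1)) f Finset.univ
  simp only [Matrix.trace, Matrix.diag, Matrix.mul_apply, hre]
  rw [Finset.sum_comm]
  exact Finset.sum_congr rfl fun i _ => Finset.sum_congr rfl fun j _ => re_mul_comm _ _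

theorem isCompact_unitary (n : ℕ) :
    IsCompact (unitary (Matrix (Fin n) (Fin n) ℍ[ℝ]) : Set (Matrix (Fin n) (Fin n) ℍ[ℝ])) := by
  have hK : IsCompact (Set.univ.pi fun _ : Fin n => Set.univ.pi fun _ : Fin n =>
      Metric.closedBall (0 : ℍ[ℝ]) 1) :=
    isCompact_univ_pi fun _ => isCompact_univ_pi fun _ => isCompact_closedBall _ _
  refine IsCompact.of_isClosed_subset hK ?_ ?_
  · have : (unitary (Matrix (Fin n) (Fin n) ℍ[ℝ]) : Set (Matrix (Fin n) (Fin n) ℍ[ℝ])) =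
        {U | Uᴴ * U = 1} ∩ {U | U * Uᴴ = 1} := by
      ext U; simp [Unitary.mem_iff, Matrix.star_eq_conjTranspose]
    rw [this]
    exact (isClosed_eq (by fun_prop) continuous_const).inter
      (isClosed_eq (by fun_prop) continuous_const)
  · intro U hU i _ j _
    have h1 : Uᴴ * U = 1 := (Unitary.mem_iff.1 hU).1
    have h2 : ((Uᴴ * U) j j).re = 1 := by rw [h1]; simp
    have hre : ∀ (k : ℕ) (f : Fin k → ℍ[ℝ]), (∑ i, f i).re = ∑ i, (f i).re := fun k f =>
      map_sum (QuaternionAlgebra.reₗ (-1 : ℝ) 0 (-1)) f Finset.univ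
    rw [Matrix.mul_apply, hre] at h2
    have h3 : ∀ k, ((Uᴴ) j k * U k j).re = ‖U k j‖ ^ 2 := by
      intro k
      rw [Matrix.conjTranspose_apply, Quaternion.star_mul_self, Quaternion.re_coe,
        Quaternion.normSq_eq_norm_mul_self, sq]
    simp only [h3] at h2
    have h4 : ‖U i j‖ ^ 2 ≤ 1 := h2 ▸ Finset.single_le_sum
      (f := fun k => ‖U k j‖ ^ 2) (fun k _ => sq_nonneg _) (Finset.mem_univ i)
    rw [mem_closedBall_zero_iff]
    nlinarith [norm_nonneg (U i j)]

/-- If multiplying by unitaries cannot increase the real trace, all values of the quadratic form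
are real and non-negative. -/
theorem quadForm_of_max {n : ℕ} {G : Matrix (Fin n) (Fin n) ℍ[ℝ]}
    (h : ∀ R ∈ unitary (Matrix (Fin n) (Fin n) ℍ[ℝ]), (G * R).trace.re ≤ G.trace.re)
    (w : Fin n → ℍ[ℝ]) (S : ℝ) (hS : 0 < S) (hw : star w ⬝ᵥ w = (S : ℍ[ℝ])) :
    star w ⬝ᵥ (G *ᵥ w) = (‖star w ⬝ᵥ (G *ᵥ w)‖ : ℝ) := by
  set a := star w ⬝ᵥ (G *ᵥ w) with ha
  by_cases ha0 : a = 0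
  · simp [ha0]
  have hna : 0 < ‖a‖ := norm_pos_iff.2 ha0
  set z : ℍ[ℝ] := ((‖a‖⁻¹ : ℝ) : ℍ[ℝ]) * star a with hz
  have haz : a * z = (‖a‖ : ℝ) := by
    rw [hz, ← mul_assoc, ← Quaternion.coe_commutes, mul_assoc, Quaternion.self_mul_star,
      Quaternion.normSq_eq_norm_mul_self, ← Quaternion.coe_mul]
    congr 1; field_simp
  have hzz : z * star z = 1 := by
    rw [Quaternion.self_mul_star, Quaternion.normSq_eq_norm_mul_self, hz, norm_mul]
    rw [norm_star, Quaternion.norm_coe, Real.norm_of_nonneg (by positivity)]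
    rw [← Quaternion.coe_one]; congr 1; field_simp
  have hzz' : star z * z = 1 := by
    rw [Quaternion.star_mul_self, ← Quaternion.self_mul_star, hzz]
  set k : ℍ[ℝ] := (z - 1) * ((S⁻¹ : ℝ) : ℍ[ℝ]) with hk
  have hSk : ((S : ℝ) : ℍ[ℝ]) * ((S⁻¹ : ℝ) : ℍ[ℝ]) = 1 := by
    rw [← Quaternion.coe_mul, mul_inv_cancel₀ hS.ne']; rfl
  have hT : ((S⁻¹ : ℝ) : ℍ[ℝ]) * ((S : ℝ) : ℍ[ℝ]) = 1 := by
    rw [← Quaternion.coe_mul, inv_mul_cancel₀ hS.ne']; rfl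
  set Wc : Matrix (Fin n) (Fin 1) ℍ[ℝ] := Matrix.of fun i _ => w i with hWc
  set Kc : Matrix (Fin 1) (Fin 1) ℍ[ℝ] := Matrix.of fun _ _ => k with hKc
  have hWW : Wcᴴ * Wc = Matrix.of fun _ _ => (S : ℍ[ℝ]) := by
    ext1 i j
    simp only [Matrix.mul_apply, Matrix.conjTranspose_apply, hWc, Matrix.of_apply, ← hw,
      dotProduct, Pi.star_apply]
  have hst : star ((S⁻¹ : ℝ) : ℍ[ℝ]) = ((S⁻¹ : ℝ) : ℍ[ℝ]) := Quaternion.star_coe _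
  have hc : ∀ x : ℍ[ℝ], ((S⁻¹ : ℝ) : ℍ[ℝ]) * x = x * ((S⁻¹ : ℝ) : ℍ[ℝ]) :=
    fun x => Quaternion.coe_commutes _ _
  have e1 : k + star k + k * (S : ℍ[ℝ]) * star k = 0 := by
    rw [hk, star_mul, hst, mul_assoc (z - 1), hT, mul_one, hc, ← add_mul, ← mul_assoc, ← add_mul,
      star_sub, star_one]
    have : z - 1 + (star z - 1) + (z - 1) * (star z - 1) = z * star z - 1 := by noncomm_ring
    rw [this, hzz]; simp
  have e2 : k + star k + star k * (S : ℍ[ℝ]) * k = 0 := by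
    rw [hk, star_mul, hst, hc, mul_assoc (star (z - 1)), hT, mul_one, ← add_mul, ← mul_assoc,
      ← add_mul, star_sub, star_one]
    have : z - 1 + (star z - 1) + (star z - 1) * (z - 1) = star z * z - 1 := by noncomm_ring
    rw [this, hzz']; simp
  set R : Matrix (Fin n) (Fin n) ℍ[ℝ] := 1 + Wc * Kc * Wcᴴ with hR
  have hRs : star R = 1 + Wc * Kcᴴ * Wcᴴ := by
    rw [hR, Matrix.star_eq_conjTranspose]
    simp [Matrix.conjTranspose_add, Matrix.conjTranspose_mul, Matrix.mul_assoc]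
  have key : ∀ L M : Matrix (Fin 1) (Fin 1) ℍ[ℝ],
      L 0 0 + M 0 0 + L 0 0 * (S : ℍ[ℝ]) * M 0 0 = 0 →
      (1 + Wc * L * Wcᴴ) * (1 + Wc * M * Wcᴴ) = 1 := by
    intro L M hLM
    have : (1 + Wc * L * Wcᴴ) * (1 + Wc * M * Wcᴴ) =
        1 + Wc * (L + M + L * (Wcᴴ * Wc) * M) * Wcᴴ := by
      simp only [Matrix.mul_add, Matrix.add_mul, Matrix.mul_one, Matrix.one_mul, Matrix.mul_assoc]
      abel
    rw [this, hWW]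
    have h0 : L + M + L * (Matrix.of fun _ _ => (S : ℍ[ℝ])) * M = 0 := by
      ext1 i j
      fin_cases i; fin_cases j
      simpa [Matrix.mul_apply] using hLM
    rw [h0]; simp
  have hRU : R ∈ unitary (Matrix (Fin n) (Fin n) ℍ[ℝ]) := by
    rw [Unitary.mem_iff, hRs]
    refine ⟨key _ _ ?_, key _ _ ?_⟩
    · have : star k + k + star k * (S : ℍ[ℝ]) * k = 0 := by rw [add_comm (star k) k]; exact e2
      simpa [hKc] using this
    · simpa [hKc] using e1
  have hle := h R hRU
  have htr : (G * (Wc * Kc * Wcᴴ)).trace.re = (a * k).re := by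
    rw [← Matrix.mul_assoc, re_trace_mul_comm, ← Matrix.mul_assoc, ← Matrix.mul_assoc]
    have : Wcᴴ * G * Wc = Matrix.of fun _ _ => a := by
      ext1 i j
      rw [Matrix.mul_assoc]
      simp only [Matrix.mul_apply, Matrix.conjTranspose_apply, hWc, Matrix.of_apply, ha,
        dotProduct, Pi.star_apply, Matrix.mulVec]
    rw [this]
    simp [Matrix.trace, Matrix.mul_apply, hKc]
  rw [hR, Matrix.mul_add, Matrix.mul_one, Matrix.trace_add, Quaternion.re_add, htr] at hle
  have hak : (a * k).re = (‖a‖ - a.re) * S⁻¹ := by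
    rw [hk, ← mul_assoc, mul_sub, haz, mul_one, ← Quaternion.coe_commutes, Quaternion.coe_mul_eq_smul,
      Quaternion.re_smul, Quaternion.re_sub, Quaternion.re_coe, smul_eq_mul, mul_comm]
  rw [hak] at hle
  have hSi : 0 < S⁻¹ := inv_pos.2 hS
  have h1 : ‖a‖ ≤ a.re := by nlinarith
  have h2 : ‖a‖ * ‖a‖ = a.re ^ 2 + a.imI ^ 2 + a.imJ ^ 2 + a.imK ^ 2 := by
    rw [← Quaternion.normSq_eq_norm_mul_self, Quaternion.normSq_def']
  have h3 : a.imI ^ 2 + a.imJ ^ 2 + a.imK ^ 2 ≤ 0 := by nlinarith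
  have hI : a.imI = 0 := by nlinarith [sq_nonneg a.imI, sq_nonneg a.imJ, sq_nonneg a.imK]
  have hJ : a.imJ = 0 := by nlinarith [sq_nonneg a.imI, sq_nonneg a.imJ, sq_nonneg a.imK]
  have hK : a.imK = 0 := by nlinarith [sq_nonneg a.imI, sq_nonneg a.imJ, sq_nonneg a.imK]
  have hre : a.re = ‖a‖ := by
    rw [hI, hJ, hK] at h2
    nlinarith
  ext <;> simp [hI, hJ, hK, hre]

theorem hermitian_of_max {n : ℕ} {G : Matrix (Fin n) (Fin n) ℍ[ℝ]}
    (h : ∀ R ∈ unitary (Matrix (Fin n) (Fin n) ℍ[ℝ]), (G * R).trace.re ≤ G.trace.re) :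
    (∀ p, G p p = (‖G p p‖ : ℝ)) ∧ ∀ p q, G q p = star (G p q) := by
  have hd : ∀ p, G p p = (‖G p p‖ : ℝ) := by
    intro p
    have := quadForm_of_max h (Pi.single p 1) 1 one_pos (by simp)
    simpa [← Pi.single_star, Matrix.mulVec_single] using this
  refine ⟨hd, fun p q => ?_⟩
  by_cases hpq : p = q
  · subst hpq
    rw [hd p]; simp
  have hq : ∀ u : ℍ[ℝ], star u * u = 1 →
      ∃ r : ℝ, G p q * u + star u * G q p = (r : ℍ[ℝ]) := by
    intro u hu
    have := quadForm_of_max h (Pi.single p 1 + Pi.single q u) 2 two_pos (by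
      simp only [star_add, ← Pi.single_star, add_dotProduct, dotProduct_add,
        single_dotProduct, Pi.single_eq_same, star_one, one_mul, hu]
      simp only [Pi.single_apply, hpq, Ne.symm hpq, if_false, mul_zero, add_zero, zero_add]
      rw [← Quaternion.coe_one, ← Quaternion.coe_add]
      norm_num)
    set N := ‖star (Pi.single p 1 + Pi.single q u : Fin n → ℍ[ℝ]) ⬝ᵥ
      (G *ᵥ (Pi.single p 1 + Pi.single q u))‖ with hN
    refine ⟨N - ‖G p p‖ - ‖G q q‖, ?_⟩
    simp only [star_add, ← Pi.single_star, add_dotProduct, dotProduct_add, Matrix.mulVec_add,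
      single_dotProduct, Matrix.mulVec_single, star_one, one_mul] at this
    simp only [Pi.smul_apply, Matrix.col_apply, MulOpposite.smul_eq_mul_unop,
      MulOpposite.unop_op, mul_one] at this
    have e : star u * (G q q * u) = G q q := by
      rw [hd q, Quaternion.coe_commutes, ← mul_assoc, hu, one_mul]
    rw [e] at this
    push_cast
    rw [← this, ← hd p, ← hd q]
    abel
  obtain ⟨r, hr⟩ := hq 1 (by simp)
  obtain ⟨e, he, he0, he1, he2, he3⟩ : ∃ e : ℍ[ℝ], star e * e = 1 ∧ e.re = 0 ∧ e.imI = 1 ∧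
      e.imJ = 0 ∧ e.imK = 0 := by
    let e : ℍ[ℝ] := ⟨0, 1, 0, 0⟩
    have h0 : e.re = 0 := rfl
    have h1 : e.imI = 1 := rfl
    have h2 : e.imJ = 0 := rfl
    have h3 : e.imK = 0 := rfl
    refine ⟨e, ?_, h0, h1, h2, h3⟩
    rw [Quaternion.star_mul_self, Quaternion.normSq_def', h0, h1, h2, h3]
    norm_num
  obtain ⟨s, hs⟩ := hq e he
  simp only [Quaternion.ext_iff] at hr hs
  simp [he0, he1, he2, he3] at hr hs
  obtain ⟨-, r1, r2, r3⟩ := hr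
  obtain ⟨-, s1, -, -⟩ := hs
  ext <;> simp <;> linarith

theorem exists_isQSVD {m n : ℕ} (A : Matrix (Fin m) (Fin n) ℍ[ℝ]) :
    ∃ U σ V, IsQSVD A U σ V := by
  set c : ℕ → ℝ := fun k => ((k : ℝ) + 1)⁻¹ with hc
  have hcpos : ∀ k, 0 < c k := fun k => by simp only [hc]; positivity
  have hclt : ∀ {k l : ℕ}, k < l → c l < c k := fun {k l} hkl => by
    simp only [hc]
    have : (k : ℝ) < l := by exact_mod_cast hkl
    gcongr
  set C : Matrix (Fin n) (Fin m) ℍ[ℝ] :=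
    Matrix.of fun j i => if (j : ℕ) = i then ((c j : ℝ) : ℍ[ℝ]) else 0 with hC
  obtain ⟨⟨U, V⟩, ⟨hU, hV⟩, hmax⟩ := ((isCompact_unitary m).prod (isCompact_unitary n)).exists_isMaxOn
    ⟨(1, 1), one_mem _, one_mem _⟩
    (f := fun P : Matrix (Fin m) (Fin m) ℍ[ℝ] × Matrix (Fin n) (Fin n) ℍ[ℝ] =>
      (C * (P.1ᴴ * A * P.2)).trace.re)
    (Continuous.continuousOn (Quaternion.continuous_re.comp (by fun_prop)))
  simp only at hU hV
  have hmax' : ∀ U' ∈ unitary (Matrix (Fin m) (Fin m) ℍ[ℝ]),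
      ∀ V' ∈ unitary (Matrix (Fin n) (Fin n) ℍ[ℝ]),
      (C * (U'ᴴ * A * V')).trace.re ≤ (C * (Uᴴ * A * V)).trace.re :=
    fun U' hU' V' hV' => hmax (a := (U', V')) ⟨hU', hV'⟩
  set B := Uᴴ * A * V with hB
  have h1 : ∀ R ∈ unitary (Matrix (Fin n) (Fin n) ℍ[ℝ]),
      ((C * B) * R).trace.re ≤ (C * B).trace.re := by
    intro R hR
    have := hmax' U hU (V * R) (mul_mem hV hR)
    rwa [← Matrix.mul_assoc (Uᴴ * A), ← Matrix.mul_assoc C] at this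
  have h2 : ∀ R ∈ unitary (Matrix (Fin m) (Fin m) ℍ[ℝ]),
      ((B * C) * R).trace.re ≤ (B * C).trace.re := by
    intro R hR
    have := hmax' (U * star R) (mul_mem hU (Unitary.star_mem hR)) V hV
    have e : (U * star R)ᴴ * A * V = R * B := by
      rw [Matrix.conjTranspose_mul, Matrix.star_eq_conjTranspose,
        Matrix.conjTranspose_conjTranspose, hB]
      simp only [Matrix.mul_assoc]
    rw [e, re_trace_mul_comm, re_trace_mul_comm C B, Matrix.mul_assoc, re_trace_mul_comm] at this
    exact this
  obtain ⟨hd1, hs1⟩ := hermitian_of_max h1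
  obtain ⟨-, hs2⟩ := hermitian_of_max h2
  have cb1 : ∀ (M : Matrix (Fin m) (Fin n) ℍ[ℝ]) (j k : Fin n) (hj : (j : ℕ) < m),
      (C * M) j k = ((c j : ℝ) : ℍ[ℝ]) * M ⟨j, hj⟩ k := by
    intro M j k hj
    rw [Matrix.mul_apply, Finset.sum_eq_single ⟨j, hj⟩]
    · simp [hC]
    · intro b _ hb
      have : (j : ℕ) ≠ b := fun h => hb (Fin.ext h.symm)
      simp [hC, this]
    · simp
  have cb0 : ∀ (M : Matrix (Fin m) (Fin n) ℍ[ℝ]) (j k : Fin n), ¬ (j : ℕ) < m →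
      (C * M) j k = 0 := by
    intro M j k hj
    rw [Matrix.mul_apply]
    refine Finset.sum_eq_zero fun i _ => ?_
    have : (j : ℕ) ≠ i := fun h => hj (h ▸ i.2)
    simp [hC, this]
  have bc1 : ∀ (i l : Fin m) (hl : (l : ℕ) < n),
      (B * C) i l = B i ⟨l, hl⟩ * ((c l : ℝ) : ℍ[ℝ]) := by
    intro i l hl
    rw [Matrix.mul_apply, Finset.sum_eq_single ⟨l, hl⟩]
    · simp [hC]
    · intro b _ hb
      have : (b : ℕ) ≠ l := fun h => hb (Fin.ext h)
      simp [hC, this]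
    · simp
  have bc0 : ∀ (i l : Fin m), ¬ (l : ℕ) < n → (B * C) i l = 0 := by
    intro i l hl
    rw [Matrix.mul_apply]
    refine Finset.sum_eq_zero fun j _ => ?_
    have : (j : ℕ) ≠ l := fun h => hl (h ▸ j.2)
    simp [hC, this]
  have hcn : ∀ k, ‖((c k : ℝ) : ℍ[ℝ])‖ = c k := fun k => by
    rw [Quaternion.norm_coe, Real.norm_of_nonneg (hcpos k).le]
  have hoff : ∀ (i : Fin m) (j : Fin n), (i : ℕ) ≠ j → B i j = 0 := by
    intro i j hij
    rw [← norm_eq_zero]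
    by_cases hi : (i : ℕ) < n
    · have a1 := congrArg norm (hs1 j ⟨i, hi⟩)
      rw [cb1 B ⟨i, hi⟩ j i.2, norm_star, norm_mul, hcn] at a1
      by_cases hj : (j : ℕ) < m
      · rw [cb1 B j _ hj, norm_mul, hcn] at a1
        have a2 := congrArg norm (hs2 ⟨j, hj⟩ i)
        rw [bc1 i ⟨j, hj⟩ j.2, bc1 ⟨j, hj⟩ i hi, norm_star, norm_mul, norm_mul, hcn, hcn] at a2
        simp only [Fin.eta] at a1 a2
        have h3 : (c i ^ 2 - c j ^ 2) * ‖B i j‖ = 0 := by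
          linear_combination c i * a1 - c j * a2
        rcases mul_eq_zero.1 h3 with h4 | h4
        · exfalso
          have h5 : c i = c j := by
            have : (c i - c j) * (c i + c j) = 0 := by linear_combination h4
            rcases mul_eq_zero.1 this with h | h
            · linarith
            · linarith [hcpos i, hcpos j]
          rcases lt_or_gt_of_ne hij with h | h
          · exact absurd h5 (hclt h).ne'
          · exact absurd h5 (hclt h).ne
        · exact h4
      · rw [cb0 B j _ hj, norm_zero] at a1
        simpa [(hcpos i).ne'] using a1
    · have hj : (j : ℕ) < m := by omega
      have a2 := congrArg norm (hs2 ⟨j, hj⟩ i)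
      rw [bc0 _ i hi, norm_star, bc1 i ⟨j, hj⟩ j.2, norm_mul, hcn, norm_zero] at a2
      simpa [(hcpos j).ne'] using a2
  have hdiag : ∀ (j : Fin n) (hj : (j : ℕ) < m), B ⟨j, hj⟩ j = ((‖B ⟨j, hj⟩ j‖ : ℝ) : ℍ[ℝ]) := by
    intro j hj
    have a1 := hd1 j
    rw [cb1 B j j hj, norm_mul, hcn, Quaternion.coe_mul] at a1
    refine mul_left_cancel₀ ?_ a1
    rw [← norm_ne_zero_iff, hcn]
    exact (hcpos j).ne'
  refine ⟨U, fun i => ‖B ⟨i, i.2.trans_le (min_le_left _ _)⟩ ⟨i, i.2.trans_le (min_le_right _ _)⟩‖,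
    V, hU, hV, fun _ => norm_nonneg _, ?_, ?_⟩
  · intro i j hij
    rcases hij.eq_or_lt with rfl | hlt
    · exact le_rfl
    obtain ⟨i, hi⟩ := i
    obtain ⟨j, hj⟩ := j
    have hlt : i < j := hlt
    have him : i < m := hi.trans_le (min_le_left _ _)
    have hin : i < n := hi.trans_le (min_le_right _ _)
    have hjm : j < m := hj.trans_le (min_le_left _ _)
    have hjn : j < n := hj.trans_le (min_le_right _ _)
    show ‖B ⟨j, hjm⟩ ⟨j, hjn⟩‖ ≤ ‖B ⟨i, him⟩ ⟨i, hin⟩‖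
    set s : Equiv.Perm (Fin m) := Equiv.swap ⟨i, him⟩ ⟨j, hjm⟩ with hs
    set t : Equiv.Perm (Fin n) := Equiv.swap ⟨i, hin⟩ ⟨j, hjn⟩ with ht
    have hperm : ∀ (k : ℕ) (Q : Matrix (Fin k) (Fin k) ℍ[ℝ]) (e : Equiv.Perm (Fin k)),
        Q ∈ unitary (Matrix (Fin k) (Fin k) ℍ[ℝ]) →
        Q.submatrix id e ∈ unitary (Matrix (Fin k) (Fin k) ℍ[ℝ]) := by
      intro k Q e hQ
      rw [Unitary.mem_iff, Matrix.star_eq_conjTranspose] at hQ ⊢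
      rw [Matrix.conjTranspose_submatrix]
      refine ⟨?_, ?_⟩
      · rw [← Matrix.submatrix_mul _ _ _ id _ Function.bijective_id, hQ.1,
          Matrix.submatrix_one_equiv]
      · rw [← Matrix.submatrix_mul _ _ _ e _ e.bijective, hQ.2, Matrix.submatrix_id_id]
    have hm := hmax' _ (hperm m U s hU) _ (hperm n V t hV)
    have e : (U.submatrix id s)ᴴ * A * V.submatrix id t = B.submatrix s t := by
      rw [hB, Matrix.conjTranspose_submatrix]
      rfl
    rw [e] at hm
    have hre : ∀ (k : ℕ) (f : Fin k → ℍ[ℝ]), (∑ i, f i).re = ∑ i, (f i).re := fun k f =>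
      map_sum (QuaternionAlgebra.reₗ (-1 : ℝ) 0 (-1)) f Finset.univ
    simp only [Matrix.trace, Matrix.diag, hre] at hm
    rw [← sub_nonneg, ← Finset.sum_sub_distrib,
      Finset.sum_eq_add (⟨i, hin⟩ : Fin n) ⟨j, hjn⟩ (by simpa using hlt.ne)] at hm
    · rw [cb1 _ ⟨i, hin⟩ _ him, cb1 _ ⟨j, hjn⟩ _ hjm, cb1 _ ⟨i, hin⟩ _ him,
        cb1 _ ⟨j, hjn⟩ _ hjm] at hm
      simp only [Matrix.submatrix_apply, hs, ht, Equiv.swap_apply_left,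
        Equiv.swap_apply_right] at hm
      rw [hdiag ⟨i, hin⟩ him, hdiag ⟨j, hjn⟩ hjm] at hm
      simp only [← Quaternion.coe_mul, Quaternion.re_coe] at hm
      have := hclt hlt
      by_contra hcon
      push Not at hcon
      nlinarith [mul_pos (sub_pos.2 this) (sub_pos.2 hcon)]
    · rintro k - ⟨hki, hkj⟩
      by_cases hk : (k : ℕ) < m
      · rw [cb1 _ _ _ hk, cb1 _ _ _ hk, Matrix.submatrix_apply, hs, ht,
          Equiv.swap_apply_of_ne_of_ne hki hkj, Equiv.swap_apply_of_ne_of_ne, sub_self]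
        · intro h; exact hki (Fin.ext (Fin.mk.inj h))
        · intro h; exact hkj (Fin.ext (Fin.mk.inj h))
      · rw [cb0 _ _ _ hk, cb0 _ _ _ hk, sub_self]
    · simp
    · simp
  · have hBd : rectDiag (fun i : Fin (min m n) =>
        ‖B ⟨i, i.2.trans_le (min_le_left _ _)⟩ ⟨i, i.2.trans_le (min_le_right _ _)⟩‖) = B := by
      ext1 i j
      simp only [rectDiag, Matrix.of_apply]
      split_ifs with h
      · have : B i j = B ⟨j, h ▸ i.2⟩ j := by congr 1; exact Fin.ext h
        rw [this, hdiag j (h ▸ i.2)]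
        simp [h]
      · exact (hoff i j h).symm
    rw [hBd, hB]
    have hU2 : U * Uᴴ = 1 := (Unitary.mem_iff.1 hU).2
    have hV2 : V * Vᴴ = 1 := (Unitary.mem_iff.1 hV).2
    calc A = (U * Uᴴ) * A * (V * Vᴴ) := by rw [hU2, hV2, Matrix.one_mul, Matrix.mul_one]
      _ = U * (Uᴴ * A * V) * Vᴴ := by simp only [Matrix.mul_assoc]

/-- The singular values of a quaternion matrix: the diagonal of a quaternion singular value
decomposition, in non-increasing order (the diagonal does not depend on the decomposition). -/
def singularValue {m n : ℕ} (A : Matrix (Fin m) (Fin n) ℍ[ℝ]) : Fin (min m n) → ℝ :=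
  (exists_isQSVD A).choose_spec.choose

/-- The nuclear norm: the sum of the singular values. -/
def nuclearNorm {m n : ℕ} (A : Matrix (Fin m) (Fin n) ℍ[ℝ]) : ℝ :=
  ∑ i, singularValue A i

/-- `∑ σ_i(A)^q`. The convention `0 ^ 0 = 0` is made explicit by summing over the positive
singular values only, so that the value at `q = 0` is the rank of `A`. -/
def singularPowSum {m n : ℕ} (q : ℝ) (A : Matrix (Fin m) (Fin n) ℍ[ℝ]) : ℝ :=
  ∑ i, if singularValue A i = 0 then 0 else |singularValue A i| ^ q

/-- The Frobenius norm. -/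
def frobNorm {m n : ℕ} (A : Matrix (Fin m) (Fin n) ℍ[ℝ]) : ℝ :=
  Real.sqrt (∑ i, ∑ j, ‖A i j‖ ^ 2)

/-- The `ℓ²` norm of a quaternion vector. -/
def vecNorm {n : ℕ} (x : Fin n → ℍ[ℝ]) : ℝ :=
  Real.sqrt (∑ i, ‖x i‖ ^ 2)

/-- The operator norm `sup_{x ≠ 0} ‖A x‖₂ / ‖x‖₂`. -/
def opNorm {m n : ℕ} (A : Matrix (Fin m) (Fin n) ℍ[ℝ]) : ℝ :=
  ⨆ x : {x : Fin n → ℍ[ℝ] // x ≠ 0}, vecNorm (A *ᵥ x.1) / vecNorm x.1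

/-- The max norm `max_{i,j} |a_ij|`. -/
def maxNorm {m n : ℕ} (A : Matrix (Fin m) (Fin n) ℍ[ℝ]) : ℝ :=
  ⨆ p : Fin m × Fin n, ‖A p.1 p.2‖

/-- The quaternion-valued inner product `⟨A, B⟩ = Tr(A* B)`. -/
def traceInner {m n : ℕ} (A B : Matrix (Fin m) (Fin n) ℍ[ℝ]) : ℍ[ℝ] :=
  (Aᴴ * B).trace

/-- Pixel matrices: every entry has zero real part and non-negative imaginary parts. -/
def pixelMatrices (m n : ℕ) : Set (Matrix (Fin m) (Fin n) ℍ[ℝ]) :=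
  {A | ∀ i j, (A i j).re = 0 ∧ 0 ≤ (A i j).imI ∧ 0 ≤ (A i j).imJ ∧ 0 ≤ (A i j).imK}

/-- The vector in `ℝ³` of the imaginary parts of a quaternion. -/
def imVec (a : ℍ[ℝ]) : Fin 3 → ℝ := ![a.imI, a.imJ, a.imK]

/-- The pure quaternion with given imaginary parts. -/
def ofImVec (v : Fin 3 → ℝ) : ℍ[ℝ] := ⟨0, v 0, v 1, v 2⟩

/-- `W q` for a real `3 × 3` matrix `W` and a pure quaternion `q`. -/
def weightMul (W : Matrix (Fin 3) (Fin 3) ℝ) (a : ℍ[ℝ]) : ℍ[ℝ] := ofImVec (W *ᵥ imVec a)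

/-- The weighted magnitude `|q|_w = √(qᵀ W q)` of a pure quaternion `q`. -/
def weightAbs (W : Matrix (Fin 3) (Fin 3) ℝ) (a : ℍ[ℝ]) : ℝ :=
  Real.sqrt (imVec a ⬝ᵥ (W *ᵥ imVec a))

/-- The weighted max norm `max_{i,j} |a_ij|_w` of a matrix with pure quaternion entries. -/
def weightMaxNorm {m n : ℕ} (W : Matrix (Fin 3) (Fin 3) ℝ) (A : Matrix (Fin m) (Fin n) ℍ[ℝ]) : ℝ :=
  ⨆ p : Fin m × Fin n, weightAbs W (A p.1 p.2)

/-- `X` is one of the matrix units `e_i e_jᵀ`. -/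
def IsMatrixUnit {m n : ℕ} (X : Matrix (Fin m) (Fin n) ℍ[ℝ]) : Prop :=
  ∃ i j, X = Matrix.single i j 1

/-- The weighted quadratic loss `(1 / 2N) ∑ |Y_k - ⟨X_k, Θ⟩|_w²`. -/
def weightedLoss {m n N : ℕ} (W : Matrix (Fin 3) (Fin 3) ℝ)
    (X : Fin N → Matrix (Fin m) (Fin n) ℍ[ℝ]) (Y : Fin N → ℍ[ℝ])
    (Θ : Matrix (Fin m) (Fin n) ℍ[ℝ]) : ℝ :=
  1 / (2 * (N : ℝ)) * ∑ k, weightAbs W (Y k - traceInner (X k) Θ) ^ 2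

/-- `Θhat` minimizes the nuclear norm over the pixel matrices with max norm at most `α` that
agree with the observations. -/
def IsCleanEstimator {m n N : ℕ} (α : ℝ) (X : Fin N → Matrix (Fin m) (Fin n) ℍ[ℝ])
    (Y : Fin N → ℍ[ℝ]) (Θhat : Matrix (Fin m) (Fin n) ℍ[ℝ]) : Prop :=
  let S := {Θ | Θ ∈ pixelMatrices m n ∧ maxNorm Θ ≤ α ∧ ∀ k, traceInner (X k) Θ = Y k}
  Θhat ∈ S ∧ IsMinOn nuclearNorm S Θhat

/-- `Θhat` minimizes the nuclear-norm regularized weighted loss over the pixel matrices with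
weighted max norm at most `α`. -/
def IsNoisyEstimator {m n N : ℕ} (W : Matrix (Fin 3) (Fin 3) ℝ) (α lam : ℝ)
    (X : Fin N → Matrix (Fin m) (Fin n) ℍ[ℝ]) (Y : Fin N → ℍ[ℝ])
    (Θhat : Matrix (Fin m) (Fin n) ℍ[ℝ]) : Prop :=
  let S := {Θ | Θ ∈ pixelMatrices m n ∧ weightMaxNorm W Θ ≤ α}
  Θhat ∈ S ∧ IsMinOn (fun Θ => weightedLoss W X Y Θ + lam * nuclearNorm Θ) S Θhat

end QMat

end

namespace QMat

variable {m n : ℕ}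

/-! Write `A` for the truth, `D` for the error and `F` for the Frobenius norm of `D`. Both
statements follow from one deterministic fact: if adding `D` raises the nuclear norm of `A` by at
most `c` times the nuclear norm of `D`, then `1 - c` times that norm is at most `5 ρ^(1/(2-q))
F^((2-2q)/(2-q))` (`nuclearNorm_le_of_add_le`).

The core is `nuclearNorm_add_ge`, proved by duality: every matrix whose form is bounded by 1 gives a
lower bound for the nuclear norm of `A + D`. In the singular bases of `A`, choose a set `t` of
singular directions and take the identity on `t` together with a dual matrix of `D` cut down to the
complementary rows and columns. The two blocks act on orthogonal subspaces, so the bound 1 survives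
(`BilinBound.partialId_add_compBlock`). Against `A` this loses at most twice the tail of singular
values outside `t`. Against `D`, the cut costs `2 √|t| F` and the identity block `√|t| F`. No
projection onto a tangent space is needed.

Next take `t` to be the singular values above `τ = (F²/ρ)^(1/(2-q))`. This level balances the two
errors: `√|t| F` and the tail are both at most `ρ^(1/(2-q)) F^((2-2q)/(2-q))`, and 3 + 2 gives the
constant 5 (`exists_split`).

In the clean model, feasibility of the truth and minimality give `c = 0`. In the corrupted model,
discarding the nonnegative quadratic term of the loss (`weightedLoss_sub_ge`) and bounding the noise
term by operator/nuclear duality give `c = 1/C₁`. -/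

theorem re_sum {ι : Type*} (s : Finset ι) (f : ι → ℍ[ℝ]) : (∑ i ∈ s, f i).re = ∑ i ∈ s, (f i).re :=
  map_sum (QuaternionAlgebra.reₗ (-1 : ℝ) 0 (-1)) f s

theorem re_star_mul_le (a b : ℍ[ℝ]) : (star a * b).re ≤ ‖a‖ * ‖b‖ := by
  have h : (star a * b).re = inner ℝ (star a) (star b) := by
    rw [Quaternion.inner_def, star_star]
  rw [h, ← norm_star a, ← norm_star b]
  exact real_inner_le_norm _ _

/-! ### Real trace pairing and Euclidean norms. -/

theorem re_traceInner (A B : Matrix (Fin m) (Fin n) ℍ[ℝ]) :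
    (traceInner A B).re = ∑ i, ∑ j, (star (A i j) * B i j).re := by
  simp only [traceInner, Matrix.trace, Matrix.diag, Matrix.mul_apply, re_sum,
    Matrix.conjTranspose_apply]
  exact Finset.sum_comm

theorem traceInner_add_left (A B C : Matrix (Fin m) (Fin n) ℍ[ℝ]) :
    traceInner (A + B) C = traceInner A C + traceInner B C := by
  simp [traceInner, Matrix.conjTranspose_add, Matrix.add_mul]

theorem traceInner_add_right (A B C : Matrix (Fin m) (Fin n) ℍ[ℝ]) :
    traceInner A (B + C) = traceInner A B + traceInner A C := by
  simp [traceInner, Matrix.mul_add]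

theorem traceInner_sub_right (A B C : Matrix (Fin m) (Fin n) ℍ[ℝ]) :
    traceInner A (B - C) = traceInner A B - traceInner A C := by
  simp [traceInner, Matrix.mul_sub]

/-- Cyclicity of the trace holds over the quaternions only for real parts, which is why every
pairing in the proof is a real part. -/
theorem re_traceInner_conj (A B : Matrix (Fin m) (Fin n) ℍ[ℝ])
    (U : Matrix (Fin m) (Fin m) ℍ[ℝ]) (V : Matrix (Fin n) (Fin n) ℍ[ℝ]) :
    (traceInner (U * A * Vᴴ) B).re = (traceInner A (Uᴴ * B * V)).re := by
  simp only [traceInner, Matrix.conjTranspose_mul, Matrix.conjTranspose_conjTranspose]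
  rw [Matrix.mul_assoc, re_trace_mul_comm]
  simp only [Matrix.mul_assoc]

theorem re_traceInner_conj' (A B : Matrix (Fin m) (Fin n) ℍ[ℝ])
    (U : Matrix (Fin m) (Fin m) ℍ[ℝ]) (V : Matrix (Fin n) (Fin n) ℍ[ℝ]) :
    (traceInner A (U * B * Vᴴ)).re = (traceInner (Uᴴ * A * V) B).re := by
  simpa using (re_traceInner_conj A B Uᴴ Vᴴ).symm

theorem re_traceInner_le (A B : Matrix (Fin m) (Fin n) ℍ[ℝ]) :
    (traceInner A B).re ≤ frobNorm A * frobNorm B := by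
  rw [re_traceInner]
  simp only [frobNorm, ← Fintype.sum_prod_type']
  exact (Finset.sum_le_sum fun p _ => re_star_mul_le _ _).trans
    (Real.sum_mul_le_sqrt_mul_sqrt _ _ _)

theorem vecNorm_nonneg (x : Fin n → ℍ[ℝ]) : 0 ≤ vecNorm x := Real.sqrt_nonneg _

theorem vecNorm_sq (x : Fin n → ℍ[ℝ]) : vecNorm x ^ 2 = ∑ i, ‖x i‖ ^ 2 :=
  Real.sq_sqrt (Finset.sum_nonneg fun _ _ => sq_nonneg _)

theorem frobNorm_nonneg (A : Matrix (Fin m) (Fin n) ℍ[ℝ]) : 0 ≤ frobNorm A := Real.sqrt_nonneg _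

theorem frobNorm_sq (A : Matrix (Fin m) (Fin n) ℍ[ℝ]) : frobNorm A ^ 2 = ∑ i, ∑ j, ‖A i j‖ ^ 2 :=
  Real.sq_sqrt (Finset.sum_nonneg fun _ _ => Finset.sum_nonneg fun _ _ => sq_nonneg _)

theorem eq_zero_of_frobNorm_eq_zero {A : Matrix (Fin m) (Fin n) ℍ[ℝ]} (h : frobNorm A = 0) :
    A = 0 := by
  have h2 := frobNorm_sq A
  rw [h, zero_pow two_ne_zero, eq_comm, Finset.sum_eq_zero_iff_of_nonneg
    fun _ _ => Finset.sum_nonneg fun _ _ => sq_nonneg _] at h2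
  ext1 i j
  have h3 := (Finset.sum_eq_zero_iff_of_nonneg fun _ _ => sq_nonneg _).1 (h2 i (Finset.mem_univ i))
    j (Finset.mem_univ j)
  simpa using h3

theorem re_dotProduct_le (x y : Fin n → ℍ[ℝ]) : (star x ⬝ᵥ y).re ≤ vecNorm x * vecNorm y := by
  simp only [dotProduct, re_sum, Pi.star_apply]
  exact (Finset.sum_le_sum fun p _ => re_star_mul_le _ _).trans
    (Real.sum_mul_le_sqrt_mul_sqrt _ _ _)

theorem re_dotProduct_self (x : Fin n → ℍ[ℝ]) : (star x ⬝ᵥ x).re = vecNorm x ^ 2 := by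
  rw [vecNorm_sq]
  simp only [dotProduct, re_sum, Pi.star_apply]
  refine Finset.sum_congr rfl fun i _ => ?_
  rw [Quaternion.star_mul_self, Quaternion.re_coe, Quaternion.normSq_eq_norm_mul_self, sq]

theorem vecNorm_mulVec_of_isometry {U : Matrix (Fin m) (Fin n) ℍ[ℝ]} (hU : Uᴴ * U = 1)
    (x : Fin n → ℍ[ℝ]) : vecNorm (U *ᵥ x) = vecNorm x := by
  have : vecNorm (U *ᵥ x) ^ 2 = vecNorm x ^ 2 := by
    rw [← re_dotProduct_self, ← re_dotProduct_self, Matrix.star_mulVec, ← Matrix.dotProduct_mulVec,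
      Matrix.mulVec_mulVec, hU, Matrix.one_mulVec]
  exact (pow_left_inj₀ (vecNorm_nonneg _) (vecNorm_nonneg _) two_ne_zero).1 this

theorem vecNorm_single (i : Fin n) : vecNorm (Pi.single i (1 : ℍ[ℝ])) = 1 := by
  have : ∀ k, ‖(Pi.single i (1 : ℍ[ℝ]) : Fin n → ℍ[ℝ]) k‖ ^ 2 = if k = i then 1 else 0 := by
    intro k
    by_cases h : k = i
    · subst h; simp
    · simp [h]
  simp [vecNorm, this]

/-! ### Matrices with bounded sesquilinear form. -/

/-- The sesquilinear form of `G` is bounded by `K`. -/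
def BilinBound (K : ℝ) (G : Matrix (Fin m) (Fin n) ℍ[ℝ]) : Prop :=
  ∀ y x, (star y ⬝ᵥ (G *ᵥ x)).re ≤ K * (vecNorm y * vecNorm x)

theorem BilinBound.conj {K : ℝ} {G : Matrix (Fin m) (Fin n) ℍ[ℝ]} (hG : BilinBound K G)
    {U : Matrix (Fin m) (Fin m) ℍ[ℝ]} {V : Matrix (Fin n) (Fin n) ℍ[ℝ]}
    (hU : U ∈ unitary (Matrix (Fin m) (Fin m) ℍ[ℝ]))
    (hV : V ∈ unitary (Matrix (Fin n) (Fin n) ℍ[ℝ])) : BilinBound K (U * G * Vᴴ) := by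
  intro y x
  have h := hG (Uᴴ *ᵥ y) (Vᴴ *ᵥ x)
  rw [vecNorm_mulVec_of_isometry ((congrArg (· * Uᴴ) U.conjTranspose_conjTranspose).trans
      (Unitary.mem_iff.1 hU).2),
    vecNorm_mulVec_of_isometry ((congrArg (· * Vᴴ) V.conjTranspose_conjTranspose).trans
      (Unitary.mem_iff.1 hV).2)] at h
  convert h using 2
  rw [Matrix.star_mulVec, ← Matrix.dotProduct_mulVec]
  simp [Matrix.mulVec_mulVec, Matrix.mul_assoc]

theorem BilinBound.conj' {K : ℝ} {G : Matrix (Fin m) (Fin n) ℍ[ℝ]} (hG : BilinBound K G)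
    {U : Matrix (Fin m) (Fin m) ℍ[ℝ]} {V : Matrix (Fin n) (Fin n) ℍ[ℝ]}
    (hU : U ∈ unitary (Matrix (Fin m) (Fin m) ℍ[ℝ]))
    (hV : V ∈ unitary (Matrix (Fin n) (Fin n) ℍ[ℝ])) : BilinBound K (Uᴴ * G * V) := by
  simpa [Matrix.star_eq_conjTranspose] using hG.conj (Unitary.star_mem hU) (Unitary.star_mem hV)

theorem BilinBound.neg {K : ℝ} {G : Matrix (Fin m) (Fin n) ℍ[ℝ]} (hG : BilinBound K G) :
    BilinBound K (-G) := by
  intro y x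
  have h := hG (-y) x
  have e : vecNorm (-y) = vecNorm y := by simp [vecNorm]
  rw [e] at h
  simpa [Matrix.neg_mulVec] using h

theorem BilinBound.re_entry_le {K : ℝ} {G : Matrix (Fin m) (Fin n) ℍ[ℝ]} (hG : BilinBound K G)
    (i : Fin m) (j : Fin n) : (G i j).re ≤ K := by
  have h := hG (Pi.single i 1) (Pi.single j 1)
  simpa [vecNorm_single, ← Pi.single_star, Matrix.mulVec_single] using h

/-- Testing the form on a basis vector and the conjugated row gives `S ≤ √S` for the squared row
norm `S`, hence `S ≤ 1`. -/
theorem BilinBound.row_le {G : Matrix (Fin m) (Fin n) ℍ[ℝ]} (hG : BilinBound 1 G) (i : Fin m) :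
    ∑ j, ‖G i j‖ ^ 2 ≤ 1 := by
  have h := hG (Pi.single i 1) (fun j => star (G i j))
  have e : vecNorm (fun j => star (G i j)) ^ 2 = ∑ j, ‖G i j‖ ^ 2 := by simp [vecNorm_sq]
  have e2 : (star (Pi.single i (1 : ℍ[ℝ])) ⬝ᵥ (G *ᵥ fun j => star (G i j))).re
      = ∑ j, ‖G i j‖ ^ 2 := by
    rw [← Pi.single_star, single_dotProduct, star_one, one_mul, Matrix.mulVec, dotProduct, re_sum]
    refine Finset.sum_congr rfl fun j _ => ?_
    rw [Quaternion.self_mul_star, Quaternion.re_coe, Quaternion.normSq_eq_norm_mul_self, sq]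
  rw [e2, ← e, vecNorm_single] at h
  rw [← e]
  nlinarith [vecNorm_nonneg (fun j => star (G i j))]

theorem BilinBound.col_le {G : Matrix (Fin m) (Fin n) ℍ[ℝ]} (hG : BilinBound 1 G) (j : Fin n) :
    ∑ i, ‖G i j‖ ^ 2 ≤ 1 := by
  have h := hG (fun i => G i j) (Pi.single j 1)
  have e2 : G *ᵥ Pi.single j (1 : ℍ[ℝ]) = fun i => G i j := by
    ext1 i; simp [Matrix.mulVec_single]
  rw [e2, re_dotProduct_self, vecNorm_single] at h
  rw [← vecNorm_sq (fun i => G i j)]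
  nlinarith [vecNorm_nonneg (fun i => G i j)]

/-- Cauchy–Schwarz in each row. It shows that the supremum defining `opNorm` is over a bounded set;
otherwise the real `⨆` would carry no information. -/
theorem vecNorm_mulVec_le_frobNorm (G : Matrix (Fin m) (Fin n) ℍ[ℝ]) (x : Fin n → ℍ[ℝ]) :
    vecNorm (G *ᵥ x) ≤ frobNorm G * vecNorm x := by
  refine Real.sqrt_le_iff.2 ⟨mul_nonneg (frobNorm_nonneg _) (vecNorm_nonneg _), ?_⟩
  rw [mul_pow, frobNorm_sq, vecNorm_sq, Finset.sum_mul]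
  refine Finset.sum_le_sum fun i _ => ?_
  have h1 : ‖(G *ᵥ x) i‖ ≤ ∑ j, ‖G i j‖ * ‖x j‖ := by
    simp only [Matrix.mulVec, dotProduct]
    exact (norm_sum_le _ _).trans_eq (Finset.sum_congr rfl fun j _ => norm_mul _ _)
  exact (pow_le_pow_left₀ (norm_nonneg _) h1 2).trans (Finset.sum_mul_sq_le_sq_mul_sq _ _ _)

theorem vecNorm_eq_zero {x : Fin n → ℍ[ℝ]} : vecNorm x = 0 ↔ x = 0 := by
  refine ⟨fun h => ?_, fun h => by simp [h, vecNorm]⟩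
  have h2 := vecNorm_sq x
  rw [h, zero_pow two_ne_zero, eq_comm,
    Finset.sum_eq_zero_iff_of_nonneg fun _ _ => sq_nonneg _] at h2
  ext1 i
  simpa using h2 i (Finset.mem_univ i)

theorem vecNorm_mulVec_le_opNorm (G : Matrix (Fin m) (Fin n) ℍ[ℝ]) (x : Fin n → ℍ[ℝ]) :
    vecNorm (G *ᵥ x) ≤ opNorm G * vecNorm x := by
  by_cases hx : x = 0
  · subst hx; simp [vecNorm]
  have hpos : 0 < vecNorm x :=
    lt_of_le_of_ne (vecNorm_nonneg x) fun h => hx (vecNorm_eq_zero.1 h.symm)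
  rw [← div_le_iff₀ hpos]
  refine le_ciSup (f := fun x : {x : Fin n → ℍ[ℝ] // x ≠ 0} => vecNorm (G *ᵥ x.1) / vecNorm x.1)
    ⟨frobNorm G, ?_⟩ ⟨x, hx⟩
  rintro _ ⟨⟨z, hz⟩, rfl⟩
  exact div_le_of_le_mul₀ (vecNorm_nonneg _) (frobNorm_nonneg _) (vecNorm_mulVec_le_frobNorm G z)

theorem bilinBound_opNorm (G : Matrix (Fin m) (Fin n) ℍ[ℝ]) : BilinBound (opNorm G) G := by
  intro y x
  calc _ ≤ vecNorm y * vecNorm (G *ᵥ x) := re_dotProduct_le _ _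
    _ ≤ vecNorm y * (opNorm G * vecNorm x) :=
      mul_le_mul_of_nonneg_left (vecNorm_mulVec_le_opNorm G x) (vecNorm_nonneg _)
    _ = _ := by ring

/-! ### Block-diagonal dual certificates. -/

/-- The diagonal `0`-`1` matrix supported on the indices in `s`. -/
noncomputable def partialId (m n : ℕ) (s : Finset ℕ) : Matrix (Fin m) (Fin n) ℍ[ℝ] :=
  Matrix.of fun i j => if (i : ℕ) = j ∧ (i : ℕ) ∈ s then 1 else 0

/-- The block of `G` whose rows and columns avoid `s`. -/
noncomputable def compBlock (s : Finset ℕ) (G : Matrix (Fin m) (Fin n) ℍ[ℝ]) :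
    Matrix (Fin m) (Fin n) ℍ[ℝ] :=
  Matrix.of fun i j => if (i : ℕ) ∉ s ∧ (j : ℕ) ∉ s then G i j else 0

/-- The entries of `x` with index in `s`. -/
noncomputable def restrict (s : Finset ℕ) (x : Fin n → ℍ[ℝ]) : Fin n → ℍ[ℝ] :=
  fun i => if (i : ℕ) ∈ s then x i else 0

/-- The entries of `x` with index outside `s`. -/
noncomputable def corestrict (s : Finset ℕ) (x : Fin n → ℍ[ℝ]) : Fin n → ℍ[ℝ] :=
  fun i => if (i : ℕ) ∈ s then 0 else x i

theorem vecNorm_restrict_add (s : Finset ℕ) (x : Fin n → ℍ[ℝ]) :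
    vecNorm (restrict s x) ^ 2 + vecNorm (corestrict s x) ^ 2 = vecNorm x ^ 2 := by
  simp only [vecNorm_sq, ← Finset.sum_add_distrib]
  refine Finset.sum_congr rfl fun i _ => ?_
  by_cases h : (i : ℕ) ∈ s <;> simp [restrict, corestrict, h]

theorem re_partialId_form_le (s : Finset ℕ) (y : Fin m → ℍ[ℝ]) (x : Fin n → ℍ[ℝ]) :
    (star y ⬝ᵥ (partialId m n s *ᵥ x)).re ≤ vecNorm (restrict s y) * vecNorm (restrict s x) := by
  have e : star y ⬝ᵥ (partialId m n s *ᵥ x) =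
      star (restrict s y) ⬝ᵥ (partialId m n s *ᵥ x) := by
    simp only [dotProduct, Pi.star_apply]
    refine Finset.sum_congr rfl fun i _ => ?_
    by_cases h : (i : ℕ) ∈ s
    · simp [restrict, h]
    · simp [restrict, h, Matrix.mulVec, partialId, dotProduct]
  rw [e]
  refine (re_dotProduct_le _ _).trans (mul_le_mul_of_nonneg_left ?_ (vecNorm_nonneg _))
  refine Real.sqrt_le_sqrt ?_
  -- Each row of the partial identity reads at most one coordinate of `x`, and each coordinate is
  -- read by at most one row. For rectangular shapes some coordinates are not read at all, so the
  -- final comparison is an inequality.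
  have h1 : ∀ i : Fin m, ‖(partialId m n s *ᵥ x) i‖ ^ 2 =
      ∑ j : Fin n, if (i : ℕ) = j then ‖restrict s x j‖ ^ 2 else 0 := by
    intro i
    by_cases hi : (i : ℕ) < n
    · have hj : ∀ j : Fin n, (i : ℕ) = j ↔ (⟨i, hi⟩ : Fin n) = j := fun j => by
        rw [Fin.ext_iff]
      by_cases h : (i : ℕ) ∈ s <;>
        simp [Matrix.mulVec, partialId, dotProduct, restrict, hj, h]
    · have hj : ∀ j : Fin n, (i : ℕ) ≠ j := fun j h => hi (h ▸ j.2)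
      simp [Matrix.mulVec, partialId, dotProduct, hj]
  simp only [h1]
  rw [Finset.sum_comm]
  refine Finset.sum_le_sum fun j _ => ?_
  by_cases hj : (j : ℕ) < m
  · have hj' : ∀ i : Fin m, (i : ℕ) = j ↔ i = (⟨j, hj⟩ : Fin m) := fun i => by
      rw [Fin.ext_iff]
    simp [hj']
  · have hj' : ∀ i : Fin m, (i : ℕ) ≠ j := fun i h => hj (h ▸ i.2)
    simp [hj']

theorem compBlock_form (s : Finset ℕ) (G : Matrix (Fin m) (Fin n) ℍ[ℝ]) (y : Fin m → ℍ[ℝ])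
    (x : Fin n → ℍ[ℝ]) :
    star y ⬝ᵥ (compBlock s G *ᵥ x) = star (corestrict s y) ⬝ᵥ (G *ᵥ corestrict s x) := by
  simp only [dotProduct, Matrix.mulVec, Finset.mul_sum]
  refine Finset.sum_congr rfl fun i _ => Finset.sum_congr rfl fun j _ => ?_
  by_cases hi : (i : ℕ) ∈ s <;> by_cases hj : (j : ℕ) ∈ s <;>
    simp [compBlock, corestrict, hi, hj]

/-- The identity block sees only coordinates in `s` and the other block only those outside, so the
form is a sum of two products of norms, controlled by Cauchy–Schwarz in the plane. -/
theorem BilinBound.partialId_add_compBlock {G : Matrix (Fin m) (Fin n) ℍ[ℝ]}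
    (hG : BilinBound 1 G) (s : Finset ℕ) : BilinBound 1 (partialId m n s + compBlock s G) := by
  intro y x
  rw [Matrix.add_mulVec, dotProduct_add, Quaternion.re_add, compBlock_form]
  have h1 := re_partialId_form_le s y x
  have h2 := hG (corestrict s y) (corestrict s x)
  have h3 := vecNorm_restrict_add s y
  have h4 := vecNorm_restrict_add s x
  have h5 : vecNorm (restrict s y) * vecNorm (restrict s x) +
      vecNorm (corestrict s y) * vecNorm (corestrict s x) ≤ vecNorm y * vecNorm x := by
    refine abs_le_of_sq_le_sq' ?_ (mul_nonneg (vecNorm_nonneg _) (vecNorm_nonneg _)) |>.2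
    rw [mul_pow, ← h3, ← h4]
    nlinarith [sq_nonneg (vecNorm (restrict s y) * vecNorm (corestrict s x) -
      vecNorm (corestrict s y) * vecNorm (restrict s x))]
  linarith

theorem bilinBound_partialId (s : Finset ℕ) : BilinBound 1 (partialId m n s) := by
  have h0 : BilinBound 1 (0 : Matrix (Fin m) (Fin n) ℍ[ℝ]) := fun y x => by
    simpa using mul_nonneg (vecNorm_nonneg y) (vecNorm_nonneg x)
  have e : compBlock s (0 : Matrix (Fin m) (Fin n) ℍ[ℝ]) = 0 := by
    ext1 i j; simp [compBlock]
  simpa [e] using h0.partialId_add_compBlock s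

/-! ### Duality between the form bound and the nuclear norm. -/

/-- The row index of the `k`-th diagonal entry. -/
def diagRow (k : Fin (min m n)) : Fin m := k.castLE (min_le_left _ _)

/-- The column index of the `k`-th diagonal entry. -/
def diagCol (k : Fin (min m n)) : Fin n := k.castLE (min_le_right _ _)

theorem re_traceInner_rectDiag (G : Matrix (Fin m) (Fin n) ℍ[ℝ]) (σ : Fin (min m n) → ℝ) :
    (traceInner G (rectDiag σ)).re = ∑ k, (G (diagRow k) (diagCol k)).re * σ k := by
  rw [re_traceInner, ← Fintype.sum_prod_type', eq_comm]
  refine Finset.sum_of_injOn (fun k => (diagRow k, diagCol k)) ?_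
    (fun _ _ => Finset.mem_coe.2 (Finset.mem_univ _)) ?_ ?_
  · intro a _ b _ h
    simpa [diagRow] using (Prod.mk.inj h).1
  · rintro ⟨i, j⟩ - h
    -- A position outside the image of the diagonal embedding is off-diagonal, where `rectDiag`
    -- vanishes.
    have hij : (i : ℕ) ≠ j := fun hij => h
      ⟨⟨i, lt_min i.2 (hij ▸ j.2)⟩, by simp, by
        simpa [diagRow, diagCol, Prod.mk.injEq, Fin.ext_iff] using hij⟩
    simp [rectDiag, hij]
  · intro k _
    simp [rectDiag, diagRow, diagCol, Quaternion.re_mul]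

theorem isQSVD_singularValue (A : Matrix (Fin m) (Fin n) ℍ[ℝ]) :
    ∃ U V, IsQSVD A U (singularValue A) V :=
  ⟨_, (exists_isQSVD A).choose_spec.choose_spec⟩

theorem singularValue_nonneg (A : Matrix (Fin m) (Fin n) ℍ[ℝ]) (i) : 0 ≤ singularValue A i := by
  obtain ⟨U, V, h⟩ := isQSVD_singularValue A
  exact h.nonneg i

theorem nuclearNorm_nonneg (A : Matrix (Fin m) (Fin n) ℍ[ℝ]) : 0 ≤ nuclearNorm A :=
  Finset.sum_nonneg fun i _ => singularValue_nonneg A i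

/-- Moving the singular bases of `A` onto `G` keeps the form bound, and then only diagonal entries,
each with real part at most `K`, meet the nonnegative singular values. -/
theorem BilinBound.re_traceInner_le {K : ℝ} {G : Matrix (Fin m) (Fin n) ℍ[ℝ]}
    (hG : BilinBound K G) (A : Matrix (Fin m) (Fin n) ℍ[ℝ]) :
    (traceInner G A).re ≤ K * nuclearNorm A := by
  obtain ⟨U, V, h⟩ := isQSVD_singularValue A
  conv_lhs => rw [h.eq]
  rw [re_traceInner_conj', re_traceInner_rectDiag, nuclearNorm, Finset.mul_sum]
  exact Finset.sum_le_sum fun k _ => mul_le_mul_of_nonneg_right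
    ((hG.conj' h.left_unitary h.right_unitary).re_entry_le _ _) (h.nonneg k)

theorem conj_conj_cancel {U : Matrix (Fin m) (Fin m) ℍ[ℝ]} {V : Matrix (Fin n) (Fin n) ℍ[ℝ]}
    (hU : U ∈ unitary (Matrix (Fin m) (Fin m) ℍ[ℝ]))
    (hV : V ∈ unitary (Matrix (Fin n) (Fin n) ℍ[ℝ])) (A : Matrix (Fin m) (Fin n) ℍ[ℝ]) :
    Uᴴ * (U * A * Vᴴ) * V = A := by
  have hU1 : Uᴴ * U = 1 := (Unitary.mem_iff.1 hU).1
  have hV1 : Vᴴ * V = 1 := (Unitary.mem_iff.1 hV).1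
  calc _ = (Uᴴ * U) * A * (Vᴴ * V) := by simp only [Matrix.mul_assoc]
    _ = A := by rw [hU1, hV1, Matrix.one_mul, Matrix.mul_one]

/-- The duality bound is attained by replacing every singular value of `A` with 1 in its
decomposition. -/
theorem exists_dual (A : Matrix (Fin m) (Fin n) ℍ[ℝ]) :
    ∃ M, BilinBound 1 M ∧ (traceInner M A).re = nuclearNorm A := by
  obtain ⟨U, V, h⟩ := isQSVD_singularValue A
  refine ⟨U * partialId m n (Finset.range m) * Vᴴ,
    (bilinBound_partialId _).conj h.left_unitary h.right_unitary, ?_⟩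
  have e : Uᴴ * A * V = rectDiag (singularValue A) := by
    conv_lhs => rw [h.eq]
    exact conj_conj_cancel h.left_unitary h.right_unitary _
  rw [re_traceInner_conj, e, re_traceInner_rectDiag, nuclearNorm]
  refine Finset.sum_congr rfl fun k _ => ?_
  simp [partialId, diagRow, diagCol]

theorem frobNorm_conj {U : Matrix (Fin m) (Fin m) ℍ[ℝ]} {V : Matrix (Fin n) (Fin n) ℍ[ℝ]}
    (hU : U ∈ unitary (Matrix (Fin m) (Fin m) ℍ[ℝ]))
    (hV : V ∈ unitary (Matrix (Fin n) (Fin n) ℍ[ℝ])) (A : Matrix (Fin m) (Fin n) ℍ[ℝ]) :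
    frobNorm (Uᴴ * A * V) = frobNorm A := by
  have key : ∀ B : Matrix (Fin m) (Fin n) ℍ[ℝ], frobNorm B ^ 2 = (traceInner B B).re := by
    intro B
    rw [frobNorm_sq, re_traceInner]
    refine Finset.sum_congr rfl fun i _ => Finset.sum_congr rfl fun j _ => ?_
    rw [Quaternion.star_mul_self, Quaternion.re_coe, Quaternion.normSq_eq_norm_mul_self, sq]
  have hU2 : U * Uᴴ = 1 := (Unitary.mem_iff.1 hU).2
  have hV2 : V * Vᴴ = 1 := (Unitary.mem_iff.1 hV).2
  refine (pow_left_inj₀ (frobNorm_nonneg _) (frobNorm_nonneg _) two_ne_zero).1 ?_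
  rw [key, key, ← re_traceInner_conj]
  congr 2
  calc _ = (U * Uᴴ) * A * (V * Vᴴ) := by simp only [Matrix.mul_assoc]
    _ = A := by rw [hU2, hV2, Matrix.one_mul, Matrix.mul_one]

/-! ### The perturbation bound. -/

theorem card_filter_mem_le (s : Finset ℕ) :
    ((Finset.univ.filter fun i : Fin m => (i : ℕ) ∈ s).card : ℝ) ≤ s.card := by
  exact_mod_cast Finset.card_le_card_of_injOn (fun i : Fin m => (i : ℕ))
    (fun i hi => by simpa using hi) (fun a _ b _ h => Fin.ext h)

theorem BilinBound.frobNorm_rows_le {G : Matrix (Fin m) (Fin n) ℍ[ℝ]} (hG : BilinBound 1 G)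
    (s : Finset ℕ) :
    frobNorm (Matrix.of fun i j => if (i : ℕ) ∈ s then G i j else 0) ≤ √s.card := by
  refine Real.sqrt_le_sqrt ((le_trans ?_ (card_filter_mem_le (m := m) s)))
  rw [Finset.card_filter, Nat.cast_sum]
  refine Finset.sum_le_sum fun i _ => ?_
  by_cases h : (i : ℕ) ∈ s
  · simpa [h] using hG.row_le i
  · simp [h]

theorem BilinBound.frobNorm_cols_le {G : Matrix (Fin m) (Fin n) ℍ[ℝ]} (hG : BilinBound 1 G)
    (s : Finset ℕ) :
    frobNorm (Matrix.of fun i j => if (j : ℕ) ∈ s ∧ (i : ℕ) ∉ s then G i j else 0) ≤ √s.card := by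
  refine Real.sqrt_le_sqrt ((le_trans ?_ (card_filter_mem_le (m := n) s)))
  rw [Finset.card_filter, Nat.cast_sum, Finset.sum_comm]
  refine Finset.sum_le_sum fun j _ => ?_
  by_cases h : (j : ℕ) ∈ s
  · simp only [h, if_true, Nat.cast_one]
    refine (Finset.sum_le_sum fun i _ => ?_).trans (hG.col_le j)
    by_cases hi : (i : ℕ) ∈ s <;> simp [h, hi]
  · simp [h]

theorem frobNorm_partialId_le (s : Finset ℕ) : frobNorm (partialId m n s) ≤ √s.card := by
  refine le_trans (le_of_eq ?_) ((bilinBound_partialId (m := m) (n := n) s).frobNorm_rows_le s)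
  congr 1
  ext1 i j
  by_cases h : (i : ℕ) ∈ s <;> simp [partialId, h]

/-- The deleted entries split into the rows in `s` and the remaining entries of the columns in `s`.
Each piece has Frobenius norm at most `√|s|`, since rows and columns of `G` have norm at most 1;
hence the factor 2. -/
theorem BilinBound.re_traceInner_compBlock_ge {G : Matrix (Fin m) (Fin n) ℍ[ℝ]}
    (hG : BilinBound 1 G) (s : Finset ℕ) (B : Matrix (Fin m) (Fin n) ℍ[ℝ]) :
    (traceInner G B).re - 2 * √s.card * frobNorm B ≤ (traceInner (compBlock s G) B).re := by
  set R : Matrix (Fin m) (Fin n) ℍ[ℝ] := Matrix.of fun i j => if (i : ℕ) ∈ s then G i j else 0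
    with hR
  set C : Matrix (Fin m) (Fin n) ℍ[ℝ] :=
    Matrix.of fun i j => if (j : ℕ) ∈ s ∧ (i : ℕ) ∉ s then G i j else 0 with hC
  have e : G = compBlock s G + (R + C) := by
    ext1 i j
    by_cases hi : (i : ℕ) ∈ s <;> by_cases hj : (j : ℕ) ∈ s <;>
      simp [compBlock, hR, hC, hi, hj]
  have e2 : (traceInner G B).re = (traceInner (compBlock s G) B).re +
      ((traceInner R B).re + (traceInner C B).re) := by
    conv_lhs => rw [e]
    rw [traceInner_add_left, traceInner_add_left, Quaternion.re_add, Quaternion.re_add]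
  have h1 := (QMat.re_traceInner_le R B).trans
    (mul_le_mul_of_nonneg_right (hG.frobNorm_rows_le s) (frobNorm_nonneg B))
  have h2 := (QMat.re_traceInner_le C B).trans
    (mul_le_mul_of_nonneg_right (hG.frobNorm_cols_le s) (frobNorm_nonneg B))
  linarith

theorem re_traceInner_partialId_ge (s : Finset ℕ) (B : Matrix (Fin m) (Fin n) ℍ[ℝ]) :
    -(√s.card * frobNorm B) ≤ (traceInner (partialId m n s) B).re := by
  have h := re_traceInner_le (partialId m n s) (-B)
  have e : frobNorm (-B) = frobNorm B := by simp [frobNorm]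
  have e2 : (traceInner (partialId m n s) (-B)).re = -(traceInner (partialId m n s) B).re := by
    simp [traceInner]
  rw [e, e2] at h
  have := mul_le_mul_of_nonneg_right (frobNorm_partialId_le (m := m) (n := n) s) (frobNorm_nonneg B)
  linarith

/-- Lower bound for the nuclear norm of a perturbation, split at a set of singular directions. -/
theorem nuclearNorm_add_ge (A D : Matrix (Fin m) (Fin n) ℍ[ℝ]) (t : Finset (Fin (min m n))) :
    nuclearNorm A + nuclearNorm D - 3 * √t.card * frobNorm D - 2 * ∑ k ∈ tᶜ, singularValue A k
      ≤ nuclearNorm (A + D) := by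
  obtain ⟨U, V, h⟩ := isQSVD_singularValue A
  obtain ⟨M, hM, hMD⟩ := exists_dual D
  set s : Finset ℕ := t.map Fin.valEmbedding with hs
  have hcard : s.card = t.card := Finset.card_map _
  have hmem : ∀ k : Fin (min m n), (k : ℕ) ∈ s ↔ k ∈ t := by
    intro k
    constructor
    · intro hk
      obtain ⟨l, hl, e⟩ := Finset.mem_map.1 hk
      rwa [← Fin.ext (show (l : ℕ) = k from e)]
    · exact fun hk => Finset.mem_map.2 ⟨k, hk, rfl⟩
  set N := Uᴴ * M * V with hN
  have hNb : BilinBound 1 N := hM.conj' h.left_unitary h.right_unitary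
  set B := Uᴴ * D * V with hB
  have hUU : U * Uᴴ = 1 := (Unitary.mem_iff.1 h.left_unitary).2
  have hVV : V * Vᴴ = 1 := (Unitary.mem_iff.1 h.right_unitary).2
  have hNB : (traceInner N B).re = nuclearNorm D := by
    rw [hB, ← re_traceInner_conj, hN, ← hMD]
    congr 2
    calc _ = (U * Uᴴ) * M * (V * Vᴴ) := by simp only [Matrix.mul_assoc]
      _ = M := by rw [hUU, hVV, Matrix.one_mul, Matrix.mul_one]
  have hBF : frobNorm B = frobNorm D := frobNorm_conj h.left_unitary h.right_unitary D
  -- The certificate, rotated back from the singular bases of `A`, is paired with the perturbed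
  -- matrix.
  have hup := ((hNb.partialId_add_compBlock s).conj h.left_unitary
    h.right_unitary).re_traceInner_le (A + D)
  have eA : Uᴴ * A * V = rectDiag (singularValue A) := by
    conv_lhs => rw [h.eq]
    exact conj_conj_cancel h.left_unitary h.right_unitary _
  rw [re_traceInner_conj, Matrix.mul_add, Matrix.add_mul, ← hB, eA, traceInner_add_right,
    Quaternion.re_add, traceInner_add_left _ _ B, Quaternion.re_add, re_traceInner_rectDiag,
    one_mul] at hup
  have h1 := hNb.re_traceInner_compBlock_ge s B
  have h2 := re_traceInner_partialId_ge s B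
  rw [hNB, hBF, hcard] at h1
  rw [hBF, hcard] at h2
  have h3 : nuclearNorm A - 2 * ∑ k ∈ tᶜ, singularValue A k ≤
      ∑ k, ((partialId m n s + compBlock s N) (diagRow k) (diagCol k)).re * singularValue A k := by
    rw [nuclearNorm, ← Finset.sum_add_sum_compl t, ← Finset.sum_add_sum_compl t (fun k =>
      ((partialId m n s + compBlock s N) (diagRow k) (diagCol k)).re * singularValue A k)]
    -- On `t` the certificate has diagonal entry exactly 1, because the complementary block vanishes
    -- there.
    have a1 : ∑ k ∈ t, ((partialId m n s + compBlock s N) (diagRow k) (diagCol k)).re *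
        singularValue A k = ∑ k ∈ t, singularValue A k := by
      refine Finset.sum_congr rfl fun k hk => ?_
      have := (hmem k).2 hk
      simp [partialId, compBlock, diagRow, diagCol, this]
    -- Off `t` only the lower bound -1 on the real diagonal entries is known. Falling from 1 to -1
    -- costs twice the tail.
    have a2 : ∑ k ∈ tᶜ, -singularValue A k ≤
        ∑ k ∈ tᶜ, ((partialId m n s + compBlock s N) (diagRow k) (diagCol k)).re *
          singularValue A k := by
      refine Finset.sum_le_sum fun k _ => ?_
      have b := (hNb.partialId_add_compBlock s).neg.re_entry_le (diagRow k) (diagCol k)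
      rw [Matrix.neg_apply, Quaternion.re_neg] at b
      nlinarith [h.nonneg k]
    rw [Finset.sum_neg_distrib] at a2
    linarith
  linarith

/-! ### Thresholding the singular values. -/

theorem singularPowSum_nonneg (q : ℝ) (A : Matrix (Fin m) (Fin n) ℍ[ℝ]) :
    0 ≤ singularPowSum q A :=
  Finset.sum_nonneg fun i _ => by
    split_ifs
    · exact le_rfl
    · positivity

/-- Thresholding the singular values at level `τ`: few are larger, and the others have a small
sum. -/
theorem threshold_bounds {q τ : ℝ} (hq0 : 0 ≤ q) (hq1 : q < 1) (hτ : 0 < τ)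
    (A : Matrix (Fin m) (Fin n) ℍ[ℝ]) :
    ∃ t : Finset (Fin (min m n)), t.card * τ ^ q ≤ singularPowSum q A ∧
      ∑ k ∈ tᶜ, singularValue A k ≤ τ ^ (1 - q) * singularPowSum q A := by
  set g : Fin (min m n) → ℝ := fun i =>
    if singularValue A i = 0 then 0 else |singularValue A i| ^ q with hg
  have hg0 : ∀ i, 0 ≤ g i := fun i => by
    simp only [hg]
    split_ifs
    · exact le_rfl
    · positivity
  have hsum : singularPowSum q A = ∑ i, g i := rfl
  refine ⟨Finset.univ.filter fun i => τ < singularValue A i, ?_, ?_⟩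
  · rw [hsum, ← nsmul_eq_mul]
    refine (Finset.card_nsmul_le_sum _ g _ fun i hi => ?_).trans
      (Finset.sum_le_sum_of_subset_of_nonneg (Finset.subset_univ _) fun i _ _ => hg0 i)
    have hi' : τ < singularValue A i := (Finset.mem_filter.1 hi).2
    have hpos := hτ.trans hi'
    simp only [hg, if_neg hpos.ne', abs_of_pos hpos]
    exact Real.rpow_le_rpow hτ.le hi'.le hq0
  · rw [hsum, Finset.mul_sum]
    refine (Finset.sum_le_sum fun i hi => ?_).trans
      (Finset.sum_le_sum_of_subset_of_nonneg (Finset.subset_univ _)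
        fun i _ _ => mul_nonneg (by positivity) (hg0 i))
    have hi' : singularValue A i ≤ τ := by simpa using hi
    rcases (singularValue_nonneg A i).eq_or_lt with h0 | hpos
    · simp [hg, ← h0]
    · simp only [hg, if_neg hpos.ne', abs_of_pos hpos]
      calc singularValue A i = singularValue A i ^ (1 - q) * singularValue A i ^ q := by
            rw [← Real.rpow_add hpos]; simp
        _ ≤ _ := by gcongr

/-- This serves the degenerate case `ρ = 0`, where the balancing threshold is undefined and the
empty set of directions is used. -/
theorem singularValue_eq_zero_of_powSum {q : ℝ} {A : Matrix (Fin m) (Fin n) ℍ[ℝ]}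
    (h : singularPowSum q A = 0) (k) : singularValue A k = 0 := by
  have h2 := (Finset.sum_eq_zero_iff_of_nonneg (fun i _ => by
    split_ifs
    · exact le_rfl
    · positivity)).1 h k (Finset.mem_univ k)
  by_contra hk
  rw [if_neg hk] at h2
  exact (Real.rpow_pos_of_pos (abs_pos.2 hk) q).ne' h2

theorem exists_split {q ρ F : ℝ} (hq0 : 0 ≤ q) (hq1 : q < 1) (hF : 0 < F)
    {A : Matrix (Fin m) (Fin n) ℍ[ℝ]} (hρ : singularPowSum q A ≤ ρ) :
    ∃ t : Finset (Fin (min m n)), 3 * √t.card * F + 2 * ∑ k ∈ tᶜ, singularValue A k ≤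
      5 * (ρ ^ (1 / (2 - q)) * F ^ ((2 - 2 * q) / (2 - q))) := by
  have hρ0 : 0 ≤ ρ := (singularPowSum_nonneg q A).trans hρ
  rcases hρ0.eq_or_lt with h0 | hρpos
  · refine ⟨∅, ?_⟩
    have h := singularValue_eq_zero_of_powSum
      (le_antisymm (hρ.trans_eq h0.symm) (singularPowSum_nonneg q A))
    simp only [h, Finset.sum_const_zero, Finset.card_empty, Nat.cast_zero, Real.sqrt_zero]
    have : 0 ≤ ρ ^ (1 / (2 - q)) * F ^ ((2 - 2 * q) / (2 - q)) := by positivity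
    linarith
  -- Writing `F` and `ρ` as exponentials turns each comparison of powers into an identity between
  -- exponents.
  obtain ⟨f, rfl⟩ : ∃ f, F = Real.exp f := ⟨_, (Real.exp_log hF).symm⟩
  obtain ⟨g, rfl⟩ : ∃ g, ρ = Real.exp g := ⟨_, (Real.exp_log hρpos).symm⟩
  have h2q : 2 - q ≠ 0 := by linarith
  -- The level is `τ = (F²/ρ)^(1/(2-q))`, which makes `τ^(1-q) ρ` and `√(ρ τ^(-q)) F` equal.
  obtain ⟨t, ht1, ht2⟩ := threshold_bounds hq0 hq1 (Real.exp_pos ((2 * f - g) / (2 - q))) A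
  refine ⟨t, ?_⟩
  rw [← Real.exp_mul, ← Real.exp_mul, ← Real.exp_add]
  rw [← Real.exp_mul] at ht1 ht2
  set R := Real.exp (g * (1 / (2 - q)) + f * ((2 - 2 * q) / (2 - q))) with hR
  have hR0 : 0 < R := Real.exp_pos _
  have b2 : ∑ k ∈ tᶜ, singularValue A k ≤ R := by
    refine ht2.trans ((mul_le_mul_of_nonneg_left hρ (Real.exp_pos _).le).trans_eq ?_)
    rw [← Real.exp_add, hR]
    congr 1
    field_simp
    ring
  have b1 : √t.card * Real.exp f ≤ R := by
    refine abs_le_of_sq_le_sq' ?_ hR0.le |>.2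
    rw [mul_pow, Real.sq_sqrt (Nat.cast_nonneg _)]
    -- Multiplying the squared inequality by `τ^q` brings in the counting bound `|t| τ^q ≤ ρ`.
    refine le_of_mul_le_mul_right ?_ (Real.exp_pos ((2 * f - g) / (2 - q) * q))
    calc _ = (t.card * Real.exp ((2 * f - g) / (2 - q) * q)) * Real.exp f ^ 2 := by ring
      _ ≤ Real.exp g * Real.exp f ^ 2 := by gcongr; exact ht1.trans hρ
      _ = _ := by
        rw [hR, ← Real.exp_nat_mul, ← Real.exp_nat_mul, ← Real.exp_add, ← Real.exp_add]
        congr 1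
        push_cast
        field_simp
        ring
  linarith

/-- A perturbation that hardly increases the nuclear norm of an approximately low-rank matrix has
nuclear norm controlled by its Frobenius norm. -/
theorem nuclearNorm_le_of_add_le {q ρ c : ℝ} (hq0 : 0 ≤ q) (hq1 : q < 1)
    {A D : Matrix (Fin m) (Fin n) ℍ[ℝ]} (hρ : singularPowSum q A ≤ ρ)
    (h : nuclearNorm (A + D) ≤ nuclearNorm A + c * nuclearNorm D) :
    (1 - c) * nuclearNorm D ≤
      5 * (ρ ^ (1 / (2 - q)) * frobNorm D ^ ((2 - 2 * q) / (2 - q))) := by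
  -- The threshold needs `F > 0`; for `F = 0` the perturbation itself is zero.
  rcases (frobNorm_nonneg D).eq_or_lt with h0 | hpos
  · have hD := eq_zero_of_frobNorm_eq_zero h0.symm
    have hn : nuclearNorm D = 0 := by
      obtain ⟨M, -, hM⟩ := exists_dual D
      rw [← hM, hD]
      simp [traceInner]
    rw [hn, mul_zero]
    have hρ0 : 0 ≤ ρ := (singularPowSum_nonneg q A).trans hρ
    have := frobNorm_nonneg D
    positivity
  · obtain ⟨t, ht⟩ := exists_split hq0 hq1 hpos hρ
    have := nuclearNorm_add_ge A D t
    linarith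

/-! ### First-order analysis of the weighted loss. -/

theorem imVec_sub (a b : ℍ[ℝ]) : imVec (a - b) = imVec a - imVec b := by
  ext i; fin_cases i <;> simp [imVec]

theorem weightAbs_sq {W : Matrix (Fin 3) (Fin 3) ℝ} (hW : W.PosDef) (a : ℍ[ℝ]) :
    weightAbs W a ^ 2 = imVec a ⬝ᵥ (W *ᵥ imVec a) :=
  Real.sq_sqrt (by simpa using hW.posSemidef.dotProduct_mulVec_nonneg (imVec a))

/-- Since `weightMul` produces a pure quaternion, the real part of `d` drops out and a Euclidean
inner product in `ℝ³` remains. -/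
theorem re_star_weightMul_mul (W : Matrix (Fin 3) (Fin 3) ℝ) (e d : ℍ[ℝ]) :
    (star (weightMul W e) * d).re = imVec d ⬝ᵥ (W *ᵥ imVec e) := by
  rw [weightMul]
  generalize W *ᵥ imVec e = v
  have h0 : (ofImVec v).re = 0 := rfl
  have h1 : (ofImVec v).imI = v 0 := rfl
  have h2 : (ofImVec v).imJ = v 1 := rfl
  have h3 : (ofImVec v).imK = v 2 := rfl
  simp only [Quaternion.re_mul, Quaternion.re_star, Quaternion.imI_star, Quaternion.imJ_star,
    Quaternion.imK_star, h0, h1, h2, h3, imVec, dotProduct, Fin.sum_univ_three]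
  simp
  ring

/-- Expand the square using the symmetry of `W` and drop the nonnegative term quadratic in `d`. -/
theorem weightAbs_sub_sq_ge {W : Matrix (Fin 3) (Fin 3) ℝ} (hW : W.PosDef) (e d : ℍ[ℝ]) :
    weightAbs W e ^ 2 - 2 * (star (weightMul W e) * d).re ≤ weightAbs W (e - d) ^ 2 := by
  have h0 : 0 ≤ imVec d ⬝ᵥ (W *ᵥ imVec d) := by
    rw [← weightAbs_sq hW]; positivity
  have hsymm : imVec e ⬝ᵥ (W *ᵥ imVec d) = imVec d ⬝ᵥ (W *ᵥ imVec e) := by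
    have hT : Wᵀ = W := by simpa using hW.isHermitian.eq
    rw [Matrix.dotProduct_mulVec, ← Matrix.mulVec_transpose, hT, dotProduct_comm]
  rw [weightAbs_sq hW, weightAbs_sq hW, re_star_weightMul_mul, imVec_sub, Matrix.mulVec_sub,
    dotProduct_sub, sub_dotProduct, sub_dotProduct, hsymm]
  linarith

/-- The only nonzero entry of a matrix unit is 1, so it commutes with the scalar; for general
quaternion matrices the conjugated scalar could not be moved out of the trace. -/
theorem traceInner_smul_left {X : Matrix (Fin m) (Fin n) ℍ[ℝ]} (hX : IsMatrixUnit X) (a : ℍ[ℝ])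
    (B : Matrix (Fin m) (Fin n) ℍ[ℝ]) :
    (traceInner (a • X) B).re = (star a * traceInner X B).re := by
  obtain ⟨i, j, rfl⟩ := hX
  simp [traceInner, Matrix.smul_single, Matrix.trace_single_mul]

theorem re_traceInner_sum_smul {N : ℕ} {X : Fin N → Matrix (Fin m) (Fin n) ℍ[ℝ]}
    (hX : ∀ k, IsMatrixUnit (X k)) (c : ℝ) (a : Fin N → ℍ[ℝ])
    (B : Matrix (Fin m) (Fin n) ℍ[ℝ]) :
    (traceInner (c • ∑ k, a k • X k) B).re = c * ∑ k, (star (a k) * traceInner (X k) B).re := by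
  have h : traceInner (c • ∑ k, a k • X k) B = c • ∑ k, traceInner (a k • X k) B := by
    have hc : (c • ∑ k, a k • X k)ᴴ = c • (∑ k, a k • X k)ᴴ := by
      ext1 i j
      exact Quaternion.star_smul _ _
    simp only [traceInner, hc, Matrix.conjTranspose_sum, Matrix.smul_mul, Matrix.trace_smul,
      Matrix.sum_mul, Matrix.trace_sum]
  rw [h, Quaternion.re_smul, re_sum, smul_eq_mul]
  simp only [traceInner_smul_left (hX _)]

/-- The first-order lower bound for the increase of the weighted loss away from the truth. -/
theorem weightedLoss_sub_ge {N : ℕ} {W : Matrix (Fin 3) (Fin 3) ℝ} (hW : W.PosDef)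
    {X : Fin N → Matrix (Fin m) (Fin n) ℍ[ℝ]} (hX : ∀ k, IsMatrixUnit (X k))
    {ε Y : Fin N → ℍ[ℝ]} {Θ : Matrix (Fin m) (Fin n) ℍ[ℝ]}
    (hY : ∀ k, Y k = traceInner (X k) Θ + ε k) (Θ' : Matrix (Fin m) (Fin n) ℍ[ℝ]) :
    weightedLoss W X Y Θ -
        (traceInner ((1 / (N : ℝ)) • ∑ k, weightMul W (ε k) • X k) (Θ' - Θ)).re ≤
      weightedLoss W X Y Θ' := by
  rw [re_traceInner_sum_smul hX]
  have e1 : weightedLoss W X Y Θ = 1 / (2 * (N : ℝ)) * ∑ k, weightAbs W (ε k) ^ 2 := by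
    simp [weightedLoss, hY]
  have e2 : weightedLoss W X Y Θ' = 1 / (2 * (N : ℝ)) *
      ∑ k, weightAbs W (ε k - traceInner (X k) (Θ' - Θ)) ^ 2 := by
    simp only [weightedLoss, hY, traceInner_sub_right]
    congr! 4
    abel
  have h := Finset.sum_le_sum fun k (_ : k ∈ Finset.univ) =>
    weightAbs_sub_sq_ge hW (ε k) (traceInner (X k) (Θ' - Θ))
  rw [Finset.sum_sub_distrib, ← Finset.mul_sum] at h
  have h' := mul_le_mul_of_nonneg_left h (show 0 ≤ 1 / (2 * (N : ℝ)) by positivity)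
  rw [e1, e2]
  refine le_trans (le_of_eq ?_) h'
  rw [mul_sub]
  congr 1
  rw [← mul_assoc]
  congr 1
  -- The 2 from the cross term cancels the one in `1 / (2N)`.
  rw [one_div, one_div, mul_inv]
  ring

end QMat

theorem lemma6 {d₁ d₂ n : ℕ} (q ρ : ℝ) (hq0 : 0 ≤ q) (hq1 : q < 1)
    (Θ : Matrix (Fin d₁) (Fin d₂) ℍ[ℝ]) (hΘ : Θ ∈ QMat.pixelMatrices d₁ d₂)
    (hρ : QMat.singularPowSum q Θ ≤ ρ)
    (X : Fin n → Matrix (Fin d₁) (Fin d₂) ℍ[ℝ]) (hX : ∀ k, QMat.IsMatrixUnit (X k)) :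
    (∀ (α : ℝ) (Y : Fin n → ℍ[ℝ]) (Θhat : Matrix (Fin d₁) (Fin d₂) ℍ[ℝ]),
      QMat.maxNorm Θ ≤ α →
      (∀ k, Y k = QMat.traceInner (X k) Θ) →
      QMat.IsCleanEstimator α X Y Θhat →
      QMat.nuclearNorm (Θhat - Θ) ≤
        5 * ρ ^ (1 / (2 - q)) * QMat.frobNorm (Θhat - Θ) ^ ((2 - 2 * q) / (2 - q))) ∧
    (∀ (W : Matrix (Fin 3) (Fin 3) ℝ) (α lam C₁ : ℝ) (ε Y : Fin n → ℍ[ℝ])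
      (Θhat : Matrix (Fin d₁) (Fin d₂) ℍ[ℝ]),
      W.PosDef →
      (∀ k, (ε k).re = 0) →
      QMat.weightMaxNorm W Θ ≤ α →
      (∀ k, Y k = QMat.traceInner (X k) Θ + ε k) →
      1 < C₁ →
      0 < lam →
      C₁ * QMat.opNorm ((1 / (n : ℝ)) • ∑ k, QMat.weightMul W (ε k) • X k) ≤ lam →
      QMat.IsNoisyEstimator W α lam X Y Θhat →
      QMat.nuclearNorm (Θhat - Θ) ≤
        5 * C₁ / (C₁ - 1) * ρ ^ (1 / (2 - q)) *
          QMat.frobNorm (Θhat - Θ) ^ ((2 - 2 * q) / (2 - q))) := by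
  refine ⟨fun α Y Θhat hα hY hest => ?_, fun W α lam C₁ ε Y Θhat hW _ hα hY hC hlam hop hest => ?_⟩
  -- The truth is itself feasible, so it competes with the minimizer.
  · have hmin : QMat.nuclearNorm Θhat ≤ QMat.nuclearNorm Θ :=
      hest.2 ⟨hΘ, hα, fun k => (hY k).symm⟩
    have h := QMat.nuclearNorm_le_of_add_le (c := 0) (D := Θhat - Θ) hq0 hq1 hρ (by simpa using hmin)
    linarith
  · have hmin : QMat.weightedLoss W X Y Θhat + lam * QMat.nuclearNorm Θhat ≤
        QMat.weightedLoss W X Y Θ + lam * QMat.nuclearNorm Θ := hest.2 ⟨hΘ, hα⟩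
    have hloss := QMat.weightedLoss_sub_ge hW hX hY Θhat
    set G := (1 / (n : ℝ)) • ∑ k, QMat.weightMul W (ε k) • X k with hG
    have hdual := (QMat.bilinBound_opNorm G).re_traceInner_le (Θhat - Θ)
    have hC0 : 0 < C₁ := by linarith
    have hop' : QMat.opNorm G ≤ lam * C₁⁻¹ := by
      rw [← div_eq_mul_inv, le_div_iff₀ hC0]; linarith
    have hN := QMat.nuclearNorm_nonneg (Θhat - Θ)
    -- The noise pairing is at most `lam / C₁` times the nuclear norm of the error; dividing the
    -- basic inequality by `lam` leaves the slack `c = 1/C₁`, and `1 / (1 - c) = C₁ / (C₁ - 1)`.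
    have h := QMat.nuclearNorm_le_of_add_le (c := C₁⁻¹) (D := Θhat - Θ) hq0 hq1 hρ (by
      rw [add_sub_cancel]
      refine le_of_mul_le_mul_left ?_ hlam
      have := mul_le_mul_of_nonneg_right hop' hN
      linarith)
    have hC1 : 0 < C₁ - 1 := by linarith
    set R := ρ ^ (1 / (2 - q)) * QMat.frobNorm (Θhat - Θ) ^ ((2 - 2 * q) / (2 - q)) with hR
    rw [mul_assoc, ← hR, div_mul_eq_mul_div, le_div_iff₀ hC1]
    have e : (1 - C₁⁻¹) * C₁ = C₁ - 1 := by field_simp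
    calc _ = ((1 - C₁⁻¹) * QMat.nuclearNorm (Θhat - Θ)) * C₁ := by rw [← e]; ring
      _ ≤ 5 * R * C₁ := by gcongr
      _ = _ := by ring
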